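/- Let $\mathbb{K}$ be a field of characteristic $0$, let $\ell : \mathbb{N}\setminus\{0\} \to \mathbb{K}^\times$ be a homomorphism of multiplicative monoids, and let $\mathcal{K}$ be a set of finite groups. For groups $F, G, H$ and subgroups $U \le F\times G$, $V \le G\times H$, put $$U * V = \{(f,h) \in F \times H : (f,g)\in U \text{ and } (g,h)\in V \text{ for some } g\in G\},$$ $$\sigma(U,V) = \ell\bigl(|\{g\in G : (1,g)\in U \text{ and } (g,1)\in V\}|\bigr) \quad \text{when } G \text{ is finite}.$$ Let $\Lambda$ be the $\mathbb{K}$-algebra with basis the symbols $s_U^{F,G}$, for $F,G\in\mathcal{K}$ and $U\le F\times G$, and with multiplication given by $s_U^{F,G}\, s_V^{G,H} = \sigma(U,V)\, s_{U*V}^{F,H}$ and $s_U^{F,G}\, s_V^{G',H} = 0$ for $G\neq G'$. When $\mathcal{K}$ is finite, $\Lambda$ is unital, with unity $\sum_{G\in\mathcal{K}} s^{G,G}_{\{(g,g)\,:\,g\in G\}}$. **Theorem 1.2.** Suppose $\mathcal{K}$ is finite and $\Lambda$ is semisimple. Let $E$ run over representatives of the isomorphism classes of the factor groups of the elements of $\mathcal{K}$,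 that is, of the groups isomorphic to $B/Y$ for some $G\in\mathcal{K}$ and subgroups $Y\trianglelefteq B\le G$. Then there is an isomorphism of $\mathbb{K}$-algebras $$\Lambda \;\cong\; \bigoplus_E \mathrm{Mat}_{n_E}\bigl(\mathbb{K}\,\mathrm{Aut}(E)\bigr),$$ where $\mathrm{Aut}(E)$ is the group of group automorphisms of $E$, $\mathbb{K}\,\mathrm{Aut}(E)$ is its group algebra, and $n_E$ is the number of triples $(G,B,Y)$ with $G\in\mathcal{K}$, $Y\trianglelefteq B\le G$ and $B/Y\cong E$. -/

import Mathlib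

universe u

noncomputable section

namespace SubgroupCategory

/-- The star product `U * V ≤ R × T` of `U ≤ R × S` and `V ≤ S × T`: the pairs `(r, t)` such that
`(r, s) ∈ U` and `(s, t) ∈ V` for some `s ∈ S`. This is the composition of the subgroup category,
in which a morphism `R ← S` is a subgroup of `R × S`. -/
def star {R S T : Type*} [Group R] [Group S] [Group T]
    (U : Subgroup (R × S)) (V : Subgroup (S × T)) : Subgroup (R × T) where
  carrier := {p | ∃ s : S, (p.1, s) ∈ U ∧ (s, p.2) ∈ V}
  one_mem' := ⟨1, U.one_mem, V.one_mem⟩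
  mul_mem' := by
    rintro p q ⟨s, hs, hs'⟩ ⟨t, ht, ht'⟩
    exact ⟨s * t, U.mul_mem hs ht, V.mul_mem hs' ht'⟩
  inv_mem' := by
    rintro p ⟨s, hs, hs'⟩
    exact ⟨s⁻¹, U.inv_mem hs, V.inv_mem hs'⟩

theorem mem_star {R S T : Type*} [Group R] [Group S] [Group T]
    {U : Subgroup (R × S)} {V : Subgroup (S × T)} {p : R × T} :
    p ∈ star U V ↔ ∃ s : S, (p.1, s) ∈ U ∧ (s, p.2) ∈ V := Iff.rfl

theorem star_assoc {R S T Q : Type*} [Group R] [Group S] [Group T] [Group Q]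
    (U : Subgroup (R × S)) (V : Subgroup (S × T)) (W : Subgroup (T × Q)) :
    star (star U V) W = star U (star V W) := by
  ext p
  simp only [mem_star]
  constructor
  · rintro ⟨t, ⟨s, h1, h2⟩, h3⟩
    exact ⟨s, h1, t, h2, h3⟩
  · rintro ⟨s, h1, t, h2, h3⟩
    exact ⟨t, ⟨s, h1, h2⟩, h3⟩

/-- The identity morphism `Δ(R) = {(r, r) : r ∈ R}` of `R` in the subgroup category. -/
def diag (R : Type*) [Group R] : Subgroup (R × R) :=
  ((MonoidHom.id R).prod (MonoidHom.id R)).range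

theorem mem_diag {R : Type*} [Group R] {p : R × R} : p ∈ diag R ↔ p.1 = p.2 := by
  constructor
  · rintro ⟨r, rfl⟩
    rfl
  · intro h
    exact ⟨p.1, Prod.ext rfl h⟩

theorem diag_star {R S : Type*} [Group R] [Group S] (U : Subgroup (R × S)) :
    star (diag R) U = U := by
  ext p
  simp [mem_star, mem_diag]

theorem star_diag {R S : Type*} [Group R] [Group S] (U : Subgroup (R × S)) :
    star U (diag S) = U := by
  ext p
  simp [mem_star, mem_diag]

/-- The subgroup `{r : (r, 1) ∈ U}` of `R`, for `U ≤ R × S`. -/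
def leftKer {R S : Type*} [Group R] [Group S] (U : Subgroup (R × S)) : Subgroup R :=
  U.comap (MonoidHom.inl R S)

/-- The subgroup `{s : (1, s) ∈ U}` of `S`, for `U ≤ R × S`. -/
def rightKer {R S : Type*} [Group R] [Group S] (U : Subgroup (R × S)) : Subgroup S :=
  U.comap (MonoidHom.inr R S)

theorem mem_leftKer {R S : Type*} [Group R] [Group S] {U : Subgroup (R × S)} {r : R} :
    r ∈ leftKer U ↔ (r, 1) ∈ U := Iff.rfl

theorem mem_rightKer {R S : Type*} [Group R] [Group S] {U : Subgroup (R × S)} {s : S} :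
    s ∈ rightKer U ↔ (1, s) ∈ U := Iff.rfl

/-- The order of a finite group, as a positive integer. -/
def order (R : Type*) [Group R] [Finite R] : ℕ+ := ⟨Nat.card R, Nat.card_pos⟩

/-- The cocycle `σ(U, V) = ℓ(|rightKer U ∩ leftKer V|)`, where `ℓ` is a monoid homomorphism from
the positive integers to the unit group of `𝕂`. -/
def sigma {𝕂 : Type*} [Field 𝕂] (ℓ : ℕ+ →* 𝕂ˣ) {R S T : Type*} [Group R] [Group S] [Group T]
    [Finite S] (U : Subgroup (R × S)) (V : Subgroup (S × T)) : 𝕂ˣ :=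
  ℓ (order ↥(rightKer U ⊓ leftKer V))

theorem order_eq_one {R : Type*} [Group R] [Finite R] {A : Subgroup R} (h : A = ⊥) :
    order ↥A = 1 := by
  subst h
  exact PNat.eq Subgroup.card_bot

theorem card_mul_card {G H : Type*} [Group G] [Group H] (A : Subgroup (G × H)) :
    Nat.card ↥(A.map (MonoidHom.fst G H)) * Nat.card ↥(rightKer A) = Nat.card ↥A := by
  have h := Subgroup.card_mul_index (((MonoidHom.fst G H).comp A.subtype).ker)
  rw [Subgroup.index_ker, MonoidHom.range_comp, Subgroup.range_subtype] at h
  rw [← h, mul_comm]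
  congr 1
  refine Nat.card_congr ⟨fun s => ⟨⟨(1, s.1), s.2⟩, rfl⟩,
    fun p => ⟨p.1.1.2, ?_⟩, fun s => rfl, ?_⟩
  · obtain ⟨⟨⟨a, b⟩, hp⟩, ha⟩ := p
    change a = 1 at ha
    subst ha
    exact hp
  · rintro ⟨⟨⟨a, b⟩, hp⟩, ha⟩
    change a = 1 at ha
    subst ha
    rfl

theorem card_mul_card' {G H : Type*} [Group G] [Group H] (A : Subgroup (G × H)) :
    Nat.card ↥(A.map (MonoidHom.snd G H)) * Nat.card ↥(leftKer A) = Nat.card ↥A := by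
  have h := Subgroup.card_mul_index (((MonoidHom.snd G H).comp A.subtype).ker)
  rw [Subgroup.index_ker, MonoidHom.range_comp, Subgroup.range_subtype] at h
  rw [← h, mul_comm]
  congr 1
  refine Nat.card_congr ⟨fun s => ⟨⟨(s.1, 1), s.2⟩, rfl⟩,
    fun p => ⟨p.1.1.1, ?_⟩, fun s => rfl, ?_⟩
  · obtain ⟨⟨⟨a, b⟩, hp⟩, ha⟩ := p
    change b = 1 at ha
    subst ha
    exact hp
  · rintro ⟨⟨⟨a, b⟩, hp⟩, ha⟩
    change b = 1 at ha
    subst ha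
    rfl

theorem card_cocycle {F G H I : Type*} [Group F] [Group G] [Group H] [Group I]
    (U : Subgroup (F × G)) (V : Subgroup (G × H)) (W : Subgroup (H × I)) :
    Nat.card ↥(rightKer U ⊓ leftKer V) * Nat.card ↥(rightKer (star U V) ⊓ leftKer W) =
      Nat.card ↥(rightKer U ⊓ leftKer (star V W)) * Nat.card ↥(rightKer V ⊓ leftKer W) := by
  let A : Subgroup (G × H) :=
    (rightKer U).comap (MonoidHom.fst G H) ⊓ V ⊓ (leftKer W).comap (MonoidHom.snd G H)
  have hA : ∀ g h, (g, h) ∈ A ↔ ((1, g) ∈ U ∧ (g, h) ∈ V) ∧ (h, 1) ∈ W := fun g h => Iff.rfl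
  have h1 : A.map (MonoidHom.fst G H) = rightKer U ⊓ leftKer (star V W) := by
    ext g
    constructor
    · rintro ⟨⟨g, h⟩, hm, rfl⟩
      obtain ⟨⟨a, b⟩, c⟩ := (hA _ _).1 hm
      exact ⟨a, h, b, c⟩
    · rintro ⟨a, h, b, c⟩
      exact ⟨(g, h), (hA _ _).2 ⟨⟨a, b⟩, c⟩, rfl⟩
  have h2 : rightKer A = rightKer V ⊓ leftKer W := by
    ext h
    constructor
    · intro hm
      obtain ⟨⟨a, b⟩, c⟩ := (hA _ _).1 hm
      exact ⟨b, c⟩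
    · rintro ⟨b, c⟩
      exact (hA _ _).2 ⟨⟨U.one_mem, b⟩, c⟩
  have h3 : A.map (MonoidHom.snd G H) = rightKer (star U V) ⊓ leftKer W := by
    ext h
    constructor
    · rintro ⟨⟨g, h⟩, hm, rfl⟩
      obtain ⟨⟨a, b⟩, c⟩ := (hA _ _).1 hm
      exact ⟨⟨g, a, b⟩, c⟩
    · rintro ⟨⟨g, a, b⟩, c⟩
      exact ⟨(g, h), (hA _ _).2 ⟨⟨a, b⟩, c⟩, rfl⟩
  have h4 : leftKer A = rightKer U ⊓ leftKer V := by
    ext g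
    constructor
    · intro hm
      obtain ⟨⟨a, b⟩, c⟩ := (hA _ _).1 hm
      exact ⟨a, b⟩
    · rintro ⟨a, b⟩
      exact (hA _ _).2 ⟨⟨a, b⟩, W.one_mem⟩
  rw [← h1, ← h2, ← h3, ← h4, card_mul_card, mul_comm, card_mul_card']

theorem sigma_cocycle {𝕂 : Type*} [Field 𝕂] (ℓ : ℕ+ →* 𝕂ˣ) {F G H I : Type*}
    [Group F] [Group G] [Group H] [Group I] [Finite G] [Finite H]
    (U : Subgroup (F × G)) (V : Subgroup (G × H)) (W : Subgroup (H × I)) :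
    sigma ℓ U V * sigma ℓ (star U V) W = sigma ℓ U (star V W) * sigma ℓ V W := by
  simp only [sigma, ← map_mul]
  congr 1
  exact PNat.eq (card_cocycle U V W)

theorem sigma_diag_left {𝕂 : Type*} [Field 𝕂] (ℓ : ℕ+ →* 𝕂ˣ) {R S : Type*} [Group R] [Group S]
    [Finite R] (U : Subgroup (R × S)) : sigma ℓ (diag R) U = 1 := by
  have h : rightKer (diag R) ⊓ leftKer U = ⊥ := by
    rw [eq_bot_iff]
    rintro r ⟨h, -⟩
    exact (mem_diag.1 h).symm
  rw [sigma, order_eq_one h, map_one]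

theorem sigma_diag_right {𝕂 : Type*} [Field 𝕂] (ℓ : ℕ+ →* 𝕂ˣ) {R S : Type*} [Group R] [Group S]
    [Finite S] (U : Subgroup (R × S)) : sigma ℓ U (diag S) = 1 := by
  have h : rightKer U ⊓ leftKer (diag S) = ⊥ := by
    rw [eq_bot_iff]
    rintro r ⟨-, h⟩
    exact mem_diag.1 h
  rw [sigma, order_eq_one h, map_one]

/-- The `𝕂`-bilinear composition of the twisted category of finite groups: the `𝕂`-module of
morphisms `R ← S` is freely generated by the subgroups of `R × S`, the generator `s_U` being
`Finsupp.single U 1`, and `s_U ∘ s_V = σ(U, V) s_{U * V}`. -/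
def comp {𝕂 : Type*} [Field 𝕂] (ℓ : ℕ+ →* 𝕂ˣ) {R S T : Type*} [Group R] [Group S] [Group T]
    [Finite S] :
    (Subgroup (R × S) →₀ 𝕂) →ₗ[𝕂] (Subgroup (S × T) →₀ 𝕂) →ₗ[𝕂] (Subgroup (R × T) →₀ 𝕂) :=
  Finsupp.linearCombination 𝕂 fun U : Subgroup (R × S) =>
    Finsupp.linearCombination 𝕂 fun V : Subgroup (S × T) =>
      Finsupp.single (star U V) (sigma ℓ U V : 𝕂)

theorem comp_single {𝕂 : Type*} [Field 𝕂] (ℓ : ℕ+ →* 𝕂ˣ) {R S T : Type*} [Group R] [Group S]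
    [Group T] [Finite S] (U : Subgroup (R × S)) (V : Subgroup (S × T)) (a b : 𝕂) :
    comp ℓ (Finsupp.single U a) (Finsupp.single V b) =
      Finsupp.single (star U V) (a * b * sigma ℓ U V) := by
  simp only [comp, Finsupp.linearCombination_single, LinearMap.smul_apply, Finsupp.smul_single,
    smul_eq_mul, mul_assoc]

theorem comp_assoc {𝕂 : Type*} [Field 𝕂] (ℓ : ℕ+ →* 𝕂ˣ) {F G H I : Type*}
    [Group F] [Group G] [Group H] [Group I] [Finite G] [Finite H]
    (x : Subgroup (F × G) →₀ 𝕂) (y : Subgroup (G × H) →₀ 𝕂) (z : Subgroup (H × I) →₀ 𝕂) :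
    comp ℓ (comp ℓ x y) z = comp ℓ x (comp ℓ y z) := by
  induction x using Finsupp.induction_linear with
  | zero => simp
  | add x x' h h' => simp [h, h']
  | single U a =>
    induction y using Finsupp.induction_linear with
    | zero => simp
    | add y y' h h' => simp [h, h']
    | single V b =>
      induction z using Finsupp.induction_linear with
      | zero => simp
      | add z z' h h' => simp [h, h']
      | single W c =>
        have h := congrArg (Units.val) (sigma_cocycle ℓ U V W)
        simp only [Units.val_mul] at h
        simp only [comp_single, star_assoc]
        congr 1
        linear_combination (a * b * c) * h

theorem diag_comp {𝕂 : Type*} [Field 𝕂] (ℓ : ℕ+ →* 𝕂ˣ) {R S : Type*} [Group R] [Group S]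
    [Finite R] (x : Subgroup (R × S) →₀ 𝕂) : comp ℓ (Finsupp.single (diag R) 1) x = x := by
  induction x using Finsupp.induction_linear with
  | zero => simp
  | add x x' h h' => simp [h, h']
  | single U a => simp [comp_single, diag_star, sigma_diag_left]

theorem comp_diag {𝕂 : Type*} [Field 𝕂] (ℓ : ℕ+ →* 𝕂ˣ) {R S : Type*} [Group R] [Group S]
    [Finite S] (x : Subgroup (R × S) →₀ 𝕂) : comp ℓ x (Finsupp.single (diag S) 1) = x := by
  induction x using Finsupp.induction_linear with
  | zero => simp
  | add x x' h h' => simp [h, h']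
  | single U a => simp [comp_single, star_diag, sigma_diag_right]

/-- The algebra `Λ` over `𝕂` associated with the twisted category whose objects are the members of
a finite set of finite groups, presented as a finite family `G`. As a `𝕂`-module it is the direct
sum, over all pairs `(i, j)`, of the free `𝕂`-module on the subgroups of `G i × G j`. Distinct
indices are distinct objects, even if the groups agree. -/
def Lam {𝕂 : Type*} [Field 𝕂] (_ℓ : ℕ+ →* 𝕂ˣ) {ι : Type*} (G : ι → Type*) [∀ i, Group (G i)] :
    Type _ :=
  ∀ i j : ι, Subgroup (G i × G j) →₀ 𝕂

namespace Lam

variable {𝕂 : Type*} [Field 𝕂] (ℓ : ℕ+ →* 𝕂ˣ) {ι : Type*} (G : ι → Type*) [∀ i, Group (G i)]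

instance instAddCommGroup : AddCommGroup (Lam ℓ G) :=
  inferInstanceAs (AddCommGroup (∀ i j : ι, Subgroup (G i × G j) →₀ 𝕂))

instance instModule : Module 𝕂 (Lam ℓ G) :=
  inferInstanceAs (Module 𝕂 (∀ i j : ι, Subgroup (G i × G j) →₀ 𝕂))

theorem add_apply (x y : Lam ℓ G) (i k : ι) : (x + y) i k = x i k + y i k := rfl

theorem zero_apply (i k : ι) : (0 : Lam ℓ G) i k = 0 := rfl

theorem smul_apply (a : 𝕂) (x : Lam ℓ G) (i k : ι) : (a • x) i k = a • x i k := rfl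

/-- The unity is the sum of the identity morphisms of the objects. -/
instance instOne [DecidableEq ι] : One (Lam ℓ G) :=
  ⟨fun i => Pi.single i (Finsupp.single (diag (G i)) 1)⟩

theorem one_apply_same [DecidableEq ι] (i : ι) : (1 : Lam ℓ G) i i = Finsupp.single (diag (G i)) 1 :=
  Pi.single_eq_same (M := fun j => Subgroup (G i × G j) →₀ 𝕂) i _

theorem one_apply_ne [DecidableEq ι] {i j : ι} (h : j ≠ i) : (1 : Lam ℓ G) i j = 0 :=
  Pi.single_eq_of_ne (M := fun j => Subgroup (G i × G j) →₀ 𝕂) h _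

variable [∀ i, Finite (G i)] [Fintype ι]

/-- Multiplication is composition of morphisms, products of incompatible morphisms being zero. -/
instance instMul : Mul (Lam ℓ G) :=
  ⟨fun x y => fun i k => ∑ j : ι, comp ℓ (x i j) (y j k)⟩

theorem mul_apply (x y : Lam ℓ G) (i k : ι) :
    (x * y) i k = ∑ j : ι, comp ℓ (x i j) (y j k) := rfl

variable [DecidableEq ι]

instance instRing : Ring (Lam ℓ G) :=
  { instAddCommGroup ℓ G, instMul ℓ G, instOne ℓ G with
    left_distrib := fun x y z => by
      funext i k
      simp only [mul_apply, add_apply, map_add, Finset.sum_add_distrib]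
    right_distrib := fun x y z => by
      funext i k
      simp only [mul_apply, add_apply, map_add, LinearMap.add_apply, Finset.sum_add_distrib]
    zero_mul := fun x => by
      funext i k
      simp [mul_apply, zero_apply]
    mul_zero := fun x => by
      funext i k
      simp [mul_apply, zero_apply]
    mul_assoc := fun x y z => by
      funext i l
      simp only [mul_apply, map_sum, LinearMap.sum_apply, comp_assoc]
      exact Finset.sum_comm
    one_mul := fun x => by
      funext i k
      rw [mul_apply, Finset.sum_eq_single i]
      · rw [one_apply_same, diag_comp]
      · intro j _ hj
        rw [one_apply_ne ℓ G hj, map_zero, LinearMap.zero_apply]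
      · simp
    mul_one := fun x => by
      funext i k
      rw [mul_apply, Finset.sum_eq_single k]
      · rw [one_apply_same, comp_diag]
      · intro j _ hj
        rw [one_apply_ne ℓ G hj.symm, map_zero]
      · simp }

instance instAlgebra : Algebra 𝕂 (Lam ℓ G) :=
  Algebra.ofModule
    (fun a x y => by
      funext i k
      simp only [mul_apply, smul_apply, map_smul, LinearMap.smul_apply, Finset.smul_sum])
    (fun a x y => by
      funext i k
      simp only [mul_apply, smul_apply, map_smul, Finset.smul_sum])

end Lam

/-- `E` is a factor group of `R` when it is isomorphic to a subquotient `B/Y`, `Y ⊴ B ≤ R`. -/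
def IsFactorGroup (E R : Type*) [Group E] [Group R] : Prop :=
  ∃ (B : Subgroup R) (Y : Subgroup B) (_ : Y.Normal), Nonempty (B ⧸ Y ≃* E)

/-- The triples `(i, B, Y)` with `Y ⊴ B ≤ G i` and `B/Y ≅ E`. -/
structure SubquotientTriple {ι : Type*} (G : ι → Type*) [∀ i, Group (G i)]
    (E : Type*) [Group E] where
  i : ι
  B : Subgroup (G i)
  Y : Subgroup B
  normal : Y.Normal
  iso : Nonempty (B ⧸ Y ≃* E)

/-- The number `n_E` of triples `(i, B, Y)` with `Y ⊴ B ≤ G i` and `B/Y ≅ E`. -/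
def numTriples {ι : Type*} (G : ι → Type*) [∀ i, Group (G i)] (E : Type*) [Group E] : ℕ :=
  Nat.card (SubquotientTriple G E)

end SubgroupCategory

end

/-!
The algebra `Λ` behaves like the algebra of a regular semigroup. By Goursat's lemma a subgroup
`U ≤ R × S` is a subquotient of `R`, a subquotient of `S` and an isomorphism between them, and its
rank is the order of these subquotients. The rank does not increase under the star product.

For a finite group `E`, a section onto `E` is a subgroup `W ≤ R × E` that is the graph of a
surjection onto `E` from a subgroup of `R`. If `U * W` is a section, then so is `W`
(`IsSection.of_star`), so `Λ` acts on the space spanned by the sections `W ≤ G i × E`, products that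
are not sections being zero. The group `Aut(E)` acts on this space from the right, compatibly with
`Λ` because the twist `σ(U, W)` depends on `W` only through its left kernel. The `Aut(E)`-action
permutes the sections freely, with one orbit for each triple `(i, B, Y)` with `B/Y ≅ E`
(`SubquotientTriple.secOf_injective`, `SubquotientTriple.mem_range_secOf`). So the space is a free
`𝕂 Aut(E)`-module of rank `n_E`, and the action is an algebra homomorphism `matrixRep` from `Λ` to
the `n_E × n_E` matrices over `𝕂 Aut(E)`.

The product of these homomorphisms over all factor groups `E` is the isomorphism. If `x` lies in its
kernel and `U` has factor group `E`, then `U = W * V` with `W` a section onto `E`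
(`exists_section_star_eq`). No section occurs in `x W`, so only morphisms of smaller rank occur in
`x U = (x W) V` up to a scalar (`rank_lt_of_comp_ne_zero`). So every element of the kernel is
nilpotent, and the kernel vanishes as `Λ` is semisimple. Finally, the dimension of the target is at
most that of `Λ`: if `T_s` and `T_t` are the chosen sections of the triples `s` and `t`, and `V°`
is the opposite of `V`, then the morphisms `T_s * (T_t * α)°`, for triples `s, t` over the same `E`
and `α ∈ Aut(E)`, are distinct (`morphismOf_injective`).
-/

noncomputable section

namespace SubgroupCategory

/-! ### Opposites, graphs of automorphisms and the rank of a morphism -/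

/-- The opposite `{(s, r) : (r, s) ∈ U}` of `U ≤ R × S`. -/
def opp {R S : Type*} [Group R] [Group S] (U : Subgroup (R × S)) : Subgroup (S × R) :=
  U.comap (MulEquiv.prodComm : S × R ≃* R × S).toMonoidHom

theorem mem_opp {R S : Type*} [Group R] [Group S] {U : Subgroup (R × S)} {s : S} {r : R} :
    (s, r) ∈ opp U ↔ (r, s) ∈ U := Iff.rfl

/-- The graph `{(α e, e) : e ∈ E}` of an automorphism, as an endomorphism of `E` in the subgroup
category. With this orientation the product of automorphisms becomes the star product. -/
def autGraph {E : Type*} [Group E] (α : MulAut E) : Subgroup (E × E) :=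
  (α.toMonoidHom.prod (MonoidHom.id E)).range

theorem mem_autGraph {E : Type*} [Group E] {α : MulAut E} {a b : E} :
    (a, b) ∈ autGraph α ↔ a = α b := by
  constructor
  · rintro ⟨e, he⟩
    obtain ⟨rfl, rfl⟩ := Prod.mk.inj he
    rfl
  · rintro rfl
    exact ⟨b, rfl⟩

theorem mem_star_autGraph {R E : Type*} [Group R] [Group E] {W : Subgroup (R × E)}
    {α : MulAut E} {r : R} {e : E} : (r, e) ∈ star W (autGraph α) ↔ (r, α e) ∈ W := by
  simp [mem_star, mem_autGraph]

theorem opp_star {R S T : Type*} [Group R] [Group S] [Group T]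
    (U : Subgroup (R × S)) (V : Subgroup (S × T)) : opp (star U V) = star (opp V) (opp U) := by
  ext ⟨t, r⟩
  simp only [mem_opp, mem_star, and_comm]

theorem opp_opp {R S : Type*} [Group R] [Group S] (U : Subgroup (R × S)) : opp (opp U) = U := rfl

theorem star_autGraph_mul {R E : Type*} [Group R] [Group E] (W : Subgroup (R × E))
    (α β : MulAut E) : star (star W (autGraph α)) (autGraph β) = star W (autGraph (α * β)) := by
  ext ⟨r, e⟩
  simp [mem_star_autGraph]

theorem star_autGraph_one {R E : Type*} [Group R] [Group E] (W : Subgroup (R × E)) :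
    star W (autGraph 1) = W := by
  ext ⟨r, e⟩
  simp [mem_star_autGraph]

theorem star_autGraph_eq_iff {R E : Type*} [Group R] [Group E] (W W' : Subgroup (R × E))
    (α : MulAut E) : star W (autGraph α) = W' ↔ W = star W' (autGraph α⁻¹) := by
  constructor <;> rintro rfl <;> rw [star_autGraph_mul] <;> simp [star_autGraph_one]

theorem leftKer_star_autGraph {R E : Type*} [Group R] [Group E] (W : Subgroup (R × E))
    (α : MulAut E) : leftKer (star W (autGraph α)) = leftKer W := by
  ext r
  simp [mem_leftKer, mem_star_autGraph]

theorem map_fst_star_autGraph {R E : Type*} [Group R] [Group E] (W : Subgroup (R × E))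
    (α : MulAut E) :
    (star W (autGraph α)).map (MonoidHom.fst R E) = W.map (MonoidHom.fst R E) := by
  ext r
  constructor
  · rintro ⟨⟨r, e⟩, h, rfl⟩
    exact ⟨(r, α e), mem_star_autGraph.1 h, rfl⟩
  · rintro ⟨⟨r, e⟩, h, rfl⟩
    exact ⟨(r, α⁻¹ e), mem_star_autGraph.2 (by simpa using h), rfl⟩

theorem autGraph_injective {E : Type*} [Group E] :
    Function.Injective (autGraph : MulAut E → Subgroup (E × E)) := by
  intro α β h
  ext e
  have : (α e, e) ∈ autGraph β := h ▸ mem_autGraph.2 rfl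
  exact mem_autGraph.1 this

/-- The order of the factor group `p₁(U) / leftKer U` attached to `U ≤ R × S`, where `p₁(U)` is the
projection of `U` to `R`. By Goursat's lemma it equals the order of the factor group attached to
`U` on the right. -/
def rank {R S : Type*} [Group R] [Group S] (U : Subgroup (R × S)) : ℕ :=
  (leftKer U).relIndex (U.map (MonoidHom.fst R S))

theorem leftKer_le_map_fst {R S : Type*} [Group R] [Group S] (U : Subgroup (R × S)) :
    leftKer U ≤ U.map (MonoidHom.fst R S) := fun r hr => ⟨(r, 1), hr, rfl⟩

theorem rank_star_le {R S T : Type*} [Group R] [Group S] [Group T] [Finite R]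
    (U : Subgroup (R × S)) (V : Subgroup (S × T)) : rank (star U V) ≤ rank U := by
  have h1 : leftKer U ≤ leftKer (star U V) := fun r hr => ⟨1, hr, V.one_mem⟩
  have h2 : (star U V).map (MonoidHom.fst R T) ≤ U.map (MonoidHom.fst R S) := by
    rintro _ ⟨⟨r, t⟩, ⟨s, hs, -⟩, rfl⟩
    exact ⟨(r, s), hs, rfl⟩
  have h3 : rank U ≠ 0 := Subgroup.FiniteIndex.index_ne_zero
  exact (Subgroup.relIndex_le_of_le_right h2
    Subgroup.FiniteIndex.index_ne_zero).trans (Subgroup.relIndex_le_of_le_left h1 h3)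

/-! ### Sections: morphisms onto a given group -/

/-- `W ≤ R × E` is a section when `W = {(b, π b) : b ∈ B}` for a surjection `π : B → E` from a
subgroup `B` of `R`, equivalently, when it projects onto `E` and has trivial right kernel. -/
def IsSection {R E : Type*} [Group R] [Group E] (W : Subgroup (R × E)) : Prop :=
  W.map (MonoidHom.snd R E) = ⊤ ∧ rightKer W = ⊥

theorem IsSection.of_star {R S E : Type*} [Group R] [Group S] [Group E] {U : Subgroup (R × S)}
    {W : Subgroup (S × E)} (h : IsSection (star U W)) : IsSection W := by
  refine ⟨?_, ?_⟩
  · rw [eq_top_iff, ← h.1]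
    rintro _ ⟨⟨r, e⟩, ⟨s, -, hs⟩, rfl⟩
    exact ⟨(s, e), hs, rfl⟩
  · rw [eq_bot_iff, ← h.2]
    exact fun e he => ⟨1, U.one_mem, he⟩

theorem IsSection.star_autGraph {R E : Type*} [Group R] [Group E] {W : Subgroup (R × E)}
    (h : IsSection W) (α : MulAut E) : IsSection (star W (autGraph α)) := by
  refine ⟨?_, ?_⟩
  · rw [eq_top_iff]
    rintro e -
    obtain ⟨⟨r, e'⟩, hr, he⟩ : α e ∈ W.map (MonoidHom.snd R E) := h.1 ▸ Subgroup.mem_top _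
    change e' = α e at he
    subst he
    exact ⟨(r, e), mem_star_autGraph.2 hr, rfl⟩
  · rw [eq_bot_iff]
    intro e he
    have : α e ∈ rightKer W := mem_star_autGraph.1 he
    rw [h.2, Subgroup.mem_bot] at this
    simpa using this

theorem IsSection.exists_mem {R E : Type*} [Group R] [Group E] {W : Subgroup (R × E)}
    (h : IsSection W) (e : E) : ∃ r, (r, e) ∈ W := by
  obtain ⟨⟨r, _⟩, hr, rfl⟩ : e ∈ W.map (MonoidHom.snd R E) := h.1 ▸ Subgroup.mem_top _
  exact ⟨r, hr⟩

theorem IsSection.eq_one {R E : Type*} [Group R] [Group E] {W : Subgroup (R × E)}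
    (h : IsSection W) {e : E} (he : (1, e) ∈ W) : e = 1 := by
  rwa [← mem_rightKer, h.2, Subgroup.mem_bot] at he

theorem IsSection.opp_star_self {R E : Type*} [Group R] [Group E] {W : Subgroup (R × E)}
    (h : IsSection W) : star (opp W) W = diag E := by
  ext ⟨e, e'⟩
  simp only [mem_star, mem_opp, mem_diag]
  constructor
  · rintro ⟨r, h1, h2⟩
    have h3 := W.mul_mem h1 (W.inv_mem h2)
    simp only [Prod.inv_mk, Prod.mk_mul_mk, mul_inv_cancel] at h3
    exact mul_inv_eq_one.1 (h.eq_one h3)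
  · rintro rfl
    obtain ⟨r, hr⟩ := h.exists_mem e
    exact ⟨r, hr, hr⟩

theorem IsSection.star_left_cancel {R E H : Type*} [Group R] [Group E] [Group H]
    {W : Subgroup (R × E)} (h : IsSection W) {V V' : Subgroup (E × H)}
    (hV : star W V = star W V') : V = V' := by
  rw [← diag_star V, ← diag_star V', ← h.opp_star_self, star_assoc, star_assoc, hV]

theorem IsSection.map_fst_star_opp {R S E : Type*} [Group R] [Group S] [Group E]
    (W : Subgroup (R × E)) {W' : Subgroup (S × E)} (h : IsSection W') :
    (star W (opp W')).map (MonoidHom.fst R S) = W.map (MonoidHom.fst R E) := by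
  ext r
  constructor
  · rintro ⟨⟨r, s⟩, ⟨e, he, -⟩, rfl⟩
    exact ⟨(r, e), he, rfl⟩
  · rintro ⟨⟨r, e⟩, he, rfl⟩
    obtain ⟨s, hs⟩ := h.exists_mem e
    exact ⟨(r, s), ⟨e, he, hs⟩, rfl⟩

theorem IsSection.leftKer_star_opp {R S E : Type*} [Group R] [Group S] [Group E]
    (W : Subgroup (R × E)) {W' : Subgroup (S × E)} (h : IsSection W') :
    leftKer (star W (opp W')) = leftKer W := by
  ext r
  constructor
  · rintro ⟨e, he, he'⟩
    obtain rfl := h.eq_one he'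
    exact he
  · exact fun hr => ⟨1, hr, W'.one_mem⟩

/-- A morphism `R ← E` that is not a section has rank less than `|E|`. -/
theorem rank_lt_of_not_isSection {R E : Type*} [Group R] [Group E] [Finite R] [Finite E]
    {W : Subgroup (R × E)} (h : ¬ IsSection W) : rank W < Nat.card E := by
  by_contra! hle
  apply h
  have h1 := card_mul_card W
  have h2 := card_mul_card' W
  have h3 : Nat.card ↥(leftKer W) * rank W = Nat.card ↥(W.map (MonoidHom.fst R E)) := by
    rw [rank, ← Subgroup.relIndex_bot_left, ← Subgroup.relIndex_bot_left]
    exact Subgroup.relIndex_mul_relIndex ⊥ _ _ bot_le (leftKer_le_map_fst W)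
  have h4 : 0 < Nat.card ↥(leftKer W) := Nat.card_pos
  have h5 : 0 < Nat.card ↥(rightKer W) := Nat.card_pos
  have h6 : Nat.card ↥(W.map (MonoidHom.snd R E)) ≤ Nat.card E := Subgroup.card_le_card_group _
  have h7 : Nat.card ↥(W.map (MonoidHom.snd R E)) = rank W * Nat.card ↥(rightKer W) := by
    apply Nat.eq_of_mul_eq_mul_right h4
    rw [h2, ← h1, ← h3]
    ring
  have h8 : 0 < Nat.card E := Nat.card_pos
  have h9 : Nat.card ↥(rightKer W) = 1 := by
    by_contra h10
    nlinarith [show 2 ≤ Nat.card ↥(rightKer W) by omega]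
  refine ⟨Subgroup.eq_top_of_card_eq _ ?_, Subgroup.eq_bot_of_card_eq _ h9⟩
  rw [h9, mul_one] at h7
  omega

/-! ### Sections attached to subquotient triples -/

namespace SubquotientTriple

variable {ι : Type*} {G : ι → Type*} [∀ i, Group (G i)] {E : Type*} [Group E]

/-- A chosen surjection `B → E` with kernel `Y`. -/
def proj (t : SubquotientTriple G E) : t.B →* E :=
  haveI := t.normal
  t.iso.some.toMonoidHom.comp (QuotientGroup.mk' t.Y)

theorem proj_surjective (t : SubquotientTriple G E) : Function.Surjective t.proj :=
  haveI := t.normal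
  t.iso.some.surjective.comp (QuotientGroup.mk'_surjective t.Y)

theorem ker_proj (t : SubquotientTriple G E) : t.proj.ker = t.Y := by
  have := t.normal
  ext b
  simp [proj]

/-- The section `{(b, π b) : b ∈ B}`, where `π : B → E` is the chosen surjection with kernel `Y`. -/
def sec (t : SubquotientTriple G E) : Subgroup (G t.i × E) :=
  (t.B.subtype.prod t.proj).range

theorem mem_sec {t : SubquotientTriple G E} {g : G t.i} {e : E} :
    (g, e) ∈ t.sec ↔ ∃ b : t.B, (b : G t.i) = g ∧ t.proj b = e := by
  simp only [sec, MonoidHom.mem_range, MonoidHom.prod_apply, Subgroup.coe_subtype, Prod.mk.injEq]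

theorem isSection_sec (t : SubquotientTriple G E) : IsSection t.sec := by
  refine ⟨?_, ?_⟩
  · rw [eq_top_iff]
    rintro e -
    obtain ⟨b, rfl⟩ := t.proj_surjective e
    exact ⟨(b, t.proj b), mem_sec.2 ⟨b, rfl, rfl⟩, rfl⟩
  · rw [eq_bot_iff]
    intro e he
    obtain ⟨b, hb, rfl⟩ := mem_sec.1 he
    obtain rfl : b = 1 := Subtype.ext hb
    simp

theorem map_fst_sec (t : SubquotientTriple G E) :
    t.sec.map (MonoidHom.fst (G t.i) E) = t.B := by
  ext g
  constructor
  · rintro ⟨⟨g, e⟩, h, rfl⟩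
    obtain ⟨b, rfl, -⟩ := mem_sec.1 h
    exact b.2
  · exact fun hg => ⟨(g, t.proj ⟨g, hg⟩), mem_sec.2 ⟨⟨g, hg⟩, rfl, rfl⟩, rfl⟩

theorem leftKer_sec (t : SubquotientTriple G E) : leftKer t.sec = t.Y.map t.B.subtype := by
  ext g
  rw [mem_leftKer, mem_sec, ← ker_proj]
  constructor
  · rintro ⟨b, rfl, hb⟩
    exact ⟨b, hb, rfl⟩
  · rintro ⟨b, hb, rfl⟩
    exact ⟨b, rfl, hb⟩

/-- The index `i` and the subgroups `Y ≤ B` of `G i` of a triple, in a form that does not mention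
`E`. -/
def data (t : SubquotientTriple G E) : Σ i, Subgroup (G i) × Subgroup (G i) :=
  ⟨t.i, t.B, t.Y.map t.B.subtype⟩

theorem data_injective : Function.Injective (data : SubquotientTriple G E → _) := by
  rintro ⟨i, B, Y, hn, hi⟩ ⟨i', B', Y', hn', hi'⟩ h
  obtain ⟨rfl, h⟩ := Sigma.mk.inj h
  obtain ⟨rfl, h⟩ := Prod.mk.inj (eq_of_heq h)
  obtain rfl := Subgroup.map_injective (Subgroup.subtype_injective B) h
  rfl

theorem nonempty_mulEquiv_of_data_eq {E' : Type*} [Group E'] {t : SubquotientTriple G E}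
    {t' : SubquotientTriple G E'} (h : t.data = t'.data) : Nonempty (E ≃* E') := by
  obtain ⟨i, B, Y, hn, ⟨f⟩⟩ := t
  obtain ⟨i', B', Y', hn', ⟨f'⟩⟩ := t'
  obtain ⟨rfl, h⟩ := Sigma.mk.inj h
  obtain ⟨rfl, h⟩ := Prod.mk.inj (eq_of_heq h)
  obtain rfl := Subgroup.map_injective (Subgroup.subtype_injective B) h
  exact ⟨f.symm.trans f'⟩

instance instFinite [Finite ι] [∀ i, Finite (G i)] : Finite (SubquotientTriple G E) :=
  Finite.of_injective _ data_injective

instance instFintype [Finite ι] [∀ i, Finite (G i)] : Fintype (SubquotientTriple G E) :=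
  Fintype.ofFinite _

/-- A triple `(i, B, Y)` can be read off from a morphism `W` whose projection is `B` and whose left
kernel is `Y`. The index enters through an equality of pairs, since `i` and `t.i` are only
propositionally equal. -/
theorem data_eq_of_section {t : SubquotientTriple G E} {i : ι} {H : Type*} [Group H]
    {W : Subgroup (G i × H)} {V : Subgroup (G t.i × H)}
    (h : (⟨i, W⟩ : Σ i, Subgroup (G i × H)) = ⟨t.i, V⟩)
    (h1 : V.map (MonoidHom.fst _ _) = t.B) (h2 : leftKer V = t.Y.map t.B.subtype) :
    t.data = ⟨i, W.map (MonoidHom.fst _ _), leftKer W⟩ := by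
  obtain ⟨rfl, h⟩ := Sigma.mk.inj h
  obtain rfl := eq_of_heq h
  rw [h1, h2, data]

/-- The sections `W ≤ G i × E` are parametrized by a triple and an automorphism of `E`. -/
def secOf (p : SubquotientTriple G E × MulAut E) : Σ i, Subgroup (G i × E) :=
  ⟨p.1.i, star p.1.sec (autGraph p.2)⟩

theorem secOf_injective :
    Function.Injective (secOf : SubquotientTriple G E × MulAut E → Σ i, Subgroup (G i × E)) := by
  rintro ⟨t, α⟩ ⟨t', α'⟩ h
  have h1 := data_eq_of_section h (by rw [map_fst_star_autGraph, map_fst_sec])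
    (by rw [leftKer_star_autGraph, leftKer_sec])
  rw [map_fst_star_autGraph, map_fst_sec, leftKer_star_autGraph, leftKer_sec] at h1
  obtain rfl : t' = t := data_injective h1
  obtain ⟨-, h⟩ := Sigma.mk.inj h
  exact Prod.ext rfl (autGraph_injective (t'.isSection_sec.star_left_cancel (eq_of_heq h)))

theorem mem_range_secOf {i : ι} {W : Subgroup (G i × E)} (hW : IsSection W) :
    (⟨i, W⟩ : Σ i, Subgroup (G i × E)) ∈ Set.range secOf := by
  -- the first projection identifies `W` with a subgroup of `G i`, from which `W` maps onto `E`
  let f₁ : W →* G i := (MonoidHom.fst (G i) E).comp W.subtype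
  let f₂ : W →* E := (MonoidHom.snd (G i) E).comp W.subtype
  have h₁ : Function.Injective f₁ := by
    rw [injective_iff_map_eq_one]
    rintro ⟨⟨g, e⟩, hge⟩ h
    change g = 1 at h
    subst h
    obtain rfl := hW.eq_one hge
    rfl
  let q : W ≃* f₁.range := MonoidHom.ofInjective h₁
  let f : f₁.range →* E := f₂.comp q.symm.toMonoidHom
  have hf : Function.Surjective f := by
    refine Function.Surjective.comp (g := f₂) ?_ q.symm.surjective
    intro e
    obtain ⟨r, hr⟩ := hW.exists_mem e
    exact ⟨⟨(r, e), hr⟩, rfl⟩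
  have hfW : ∀ (g : G i) (e : E), (g, e) ∈ W ↔ ∃ b : f₁.range, (b : G i) = g ∧ f b = e := by
    intro g e
    constructor
    · intro h
      refine ⟨q ⟨(g, e), h⟩, rfl, ?_⟩
      simp [f, f₂]
    · rintro ⟨b, rfl, rfl⟩
      obtain ⟨w, rfl⟩ := q.surjective b
      have h : f (q w) = w.1.2 := by simp [f, f₂]
      rw [h]
      exact w.2
  let t : SubquotientTriple G E :=
    ⟨i, f₁.range, f.ker, inferInstance, ⟨QuotientGroup.quotientKerEquivOfSurjective f hf⟩⟩
  -- the chosen surjection of `t` and `f` have the same kernel, so they differ by an automorphism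
  have hker : t.proj.ker = f.ker := t.ker_proj
  let φ := QuotientGroup.quotientKerEquivOfSurjective t.proj t.proj_surjective
  let ψ := QuotientGroup.quotientKerEquivOfSurjective f hf
  let α : MulAut E := (ψ.symm.trans (QuotientGroup.quotientMulEquivOfEq hker.symm)).trans φ
  have hα : ∀ b : f₁.range, α (f b) = t.proj b := by
    intro b
    have : ψ.symm (f b) = QuotientGroup.mk b := by
      rw [MulEquiv.symm_apply_eq]
      rfl
    change φ (QuotientGroup.quotientMulEquivOfEq hker.symm (ψ.symm (f b))) = _
    rw [this]
    rfl
  refine ⟨(t, α), ?_⟩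
  suffices h : star t.sec (autGraph α) = W from Sigma.ext rfl (heq_of_eq h)
  ext ⟨g, e⟩
  rw [mem_star_autGraph, mem_sec, hfW]
  refine exists_congr fun b => and_congr_right fun _ => ?_
  rw [← hα, α.injective.eq_iff]

end SubquotientTriple

/-! ### Factoring morphisms through their factor groups -/

/-- Every `U ≤ R × S` is `W * V` for a section `W` onto the factor group of `U`: this is the
regularity `U = U * U° * U` of the subgroup category, factored through `p₁(U) / leftKer U`. -/
theorem exists_section_star_eq {R S E : Type*} [Group R] [Group S] [Group E]
    (U : Subgroup (R × S)) {f : U.map (MonoidHom.fst R S) →* E} (hf : Function.Surjective f)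
    (hker : f.ker = (leftKer U).subgroupOf _) :
    ∃ (W : Subgroup (R × E)) (V : Subgroup (E × S)), IsSection W ∧ star W V = U := by
  let W : Subgroup (R × E) := ((U.map (MonoidHom.fst R S)).subtype.prod f).range
  have hW : ∀ r e, (r, e) ∈ W ↔ ∃ b : U.map (MonoidHom.fst R S), (b : R) = r ∧ f b = e := by
    intro r e
    simp only [W, MonoidHom.mem_range, MonoidHom.prod_apply, Subgroup.coe_subtype, Prod.mk.injEq]
  refine ⟨W, star (opp W) U, ⟨?_, ?_⟩, ?_⟩
  · rw [eq_top_iff]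
    rintro e -
    obtain ⟨b, rfl⟩ := hf e
    exact ⟨(b, f b), (hW _ _).2 ⟨b, rfl, rfl⟩, rfl⟩
  · rw [eq_bot_iff]
    intro e he
    obtain ⟨b, hb, rfl⟩ := (hW _ _).1 he
    obtain rfl : b = 1 := Subtype.ext hb
    simp
  · ext ⟨r, s⟩
    constructor
    · rintro ⟨e, h1, r', h2, h3⟩
      obtain ⟨b, rfl, rfl⟩ := (hW _ _).1 h1
      obtain ⟨b', rfl, hb⟩ := (hW _ _).1 h2
      have h4 : b * b'⁻¹ ∈ f.ker := by simp [MonoidHom.mem_ker, hb]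
      rw [hker, Subgroup.mem_subgroupOf] at h4
      simpa using U.mul_mem (mem_leftKer.1 h4) h3
    · intro h
      let b : U.map (MonoidHom.fst R S) := ⟨r, (r, s), h, rfl⟩
      have hb := (hW r (f b)).2 ⟨b, rfl, rfl⟩
      exact ⟨f b, hb, r, hb, h⟩

theorem normal_leftKer {R S : Type*} [Group R] [Group S] (U : Subgroup (R × S)) :
    ((leftKer U).subgroupOf (U.map (MonoidHom.fst R S))).Normal := by
  refine ⟨fun n hn g => ?_⟩
  obtain ⟨_, ⟨r, s⟩, hg, rfl⟩ := g
  rw [Subgroup.mem_subgroupOf, mem_leftKer] at hn ⊢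
  simpa using U.mul_mem (U.mul_mem hg hn) (U.inv_mem hg)

/-! ### The matrix representation attached to a factor group -/

section Coefficients

variable {𝕂 : Type*} [Field 𝕂] (ℓ : ℕ+ →* 𝕂ˣ) {R S T E : Type*} [Group R] [Group S] [Group T]
  [Group E] [Finite S]

theorem sigma_star_autGraph (U : Subgroup (R × S)) (W : Subgroup (S × E)) (β : MulAut E) :
    sigma ℓ U (star W (autGraph β)) = sigma ℓ U W := by
  rw [sigma, sigma]
  congr 1
  apply PNat.eq
  rw [order, order, PNat.mk_coe, PNat.mk_coe, leftKer_star_autGraph]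

theorem comp_star_autGraph_apply (x : Subgroup (R × S) →₀ 𝕂) (W : Subgroup (S × E))
    (Z : Subgroup (R × E)) (β : MulAut E) :
    comp ℓ x (Finsupp.single (star W (autGraph β)) 1) Z =
      comp ℓ x (Finsupp.single W 1) (star Z (autGraph β⁻¹)) := by
  classical
  induction x using Finsupp.induction_linear with
  | zero => simp
  | add x x' h h' => simp [h, h']
  | single U a =>
    simp only [comp_single, Finsupp.single_apply, sigma_star_autGraph, ← star_assoc,
      star_autGraph_eq_iff]

theorem comp_single_apply_eq_zero (x : Subgroup (R × S) →₀ 𝕂) {W : Subgroup (S × E)}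
    {Z : Subgroup (R × E)} (hW : ¬ IsSection W) (hZ : IsSection Z) (b : 𝕂) :
    comp ℓ x (Finsupp.single W b) Z = 0 := by
  classical
  induction x using Finsupp.induction_linear with
  | zero => simp
  | add x x' h h' => simp [h, h']
  | single U a =>
    rw [comp_single, Finsupp.single_apply, if_neg]
    rintro rfl
    exact hW hZ.of_star

theorem comp_apply_eq_sum [Fintype (Subgroup (S × T))] (x : Subgroup (R × S) →₀ 𝕂)
    (y : Subgroup (S × T) →₀ 𝕂) (Z : Subgroup (R × T)) :
    comp ℓ x y Z = ∑ W, y W * comp ℓ x (Finsupp.single W 1) Z := by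
  classical
  induction y using Finsupp.induction_linear with
  | zero => simp
  | add y y' h h' => simp [h, h', add_mul, Finset.sum_add_distrib]
  | single V b =>
    rw [← mul_one b, ← smul_eq_mul, ← Finsupp.smul_single, map_smul]
    simp [Finsupp.single_apply]

end Coefficients

section Representation

section

variable {𝕂 : Type*} [Field 𝕂] (ℓ : ℕ+ →* 𝕂ˣ) {ι : Type*} {G : ι → Type*} [∀ i, Group (G i)]
  [∀ i, Finite (G i)] {E : Type*} [Group E]

theorem comp_one_single_apply [DecidableEq ι] {i j : ι}
    (W : Subgroup (G j × E)) (Z : Subgroup (G i × E)) :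
    comp ℓ ((1 : Lam ℓ G) i j) (Finsupp.single W 1) Z =
      open Classical in if (⟨i, Z⟩ : Σ i, Subgroup (G i × E)) = ⟨j, W⟩ then 1 else 0 := by
  classical
  by_cases hij : j = i
  · subst hij
    rw [Lam.one_apply_same, diag_comp, Finsupp.single_apply]
    congr 1
    simp [eq_comm]
  · rw [Lam.one_apply_ne ℓ G hij, if_neg fun h => hij (congrArg Sigma.fst h).symm]
    simp

end

variable {𝕂 : Type*} [Field 𝕂] (ℓ : ℕ+ →* 𝕂ˣ) {ι : Type*} (G : ι → Type*) [∀ i, Group (G i)]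
  [∀ i, Finite (G i)] (E : Type*) [Group E] [Finite E]

/-- The entry in row `s` and column `t` of the matrix representing `x`: its coefficient at `α` is
the coefficient of `T_s * α` in `x T_t`, where `T_s` and `T_t` are the sections of `s` and `t`. -/
def entry (x : Lam ℓ G) (s t : SubquotientTriple G E) : MonoidAlgebra 𝕂 (MulAut E) :=
  MonoidAlgebra.ofCoeff <| Finsupp.equivFunOnFinite.symm fun α =>
    comp ℓ (x s.i t.i) (Finsupp.single t.sec 1) (star s.sec (autGraph α))

variable {G E}

theorem entry_coeff (x : Lam ℓ G) (s t : SubquotientTriple G E) (α : MulAut E) :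
    (entry ℓ G E x s t).coeff α =
      comp ℓ (x s.i t.i) (Finsupp.single t.sec 1) (star s.sec (autGraph α)) := rfl

theorem entry_one [DecidableEq ι] [DecidableEq (SubquotientTriple G E)]
    (s t : SubquotientTriple G E) :
    entry ℓ G E (1 : Lam ℓ G) s t = if s = t then 1 else 0 := by
  classical
  apply MonoidAlgebra.coeff_injective
  ext α
  have h : (⟨t.i, t.sec⟩ : Σ i, Subgroup (G i × E)) = SubquotientTriple.secOf (t, 1) := by
    rw [SubquotientTriple.secOf, star_autGraph_one]
  have h' : (⟨s.i, star s.sec (autGraph α)⟩ : Σ i, Subgroup (G i × E)) =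
    SubquotientTriple.secOf (s, α) := rfl
  rw [entry_coeff, comp_one_single_apply, h, h']
  simp only [SubquotientTriple.secOf_injective.eq_iff]
  by_cases hst : s = t
  · simp [hst, MonoidAlgebra.one_def, Finsupp.single_apply, eq_comm]
  · simp [hst]

variable [Fintype ι]

theorem entry_mul (x y : Lam ℓ G) (s t : SubquotientTriple G E) :
    entry ℓ G E (x * y) s t = ∑ r, entry ℓ G E x s r * entry ℓ G E y r t := by
  classical
  have := Fintype.ofFinite (MulAut E)
  have (j : ι) : Fintype (Subgroup (G j × E)) := Fintype.ofFinite _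
  apply MonoidAlgebra.coeff_injective
  ext γ
  have hZ : IsSection (star s.sec (autGraph γ)) := s.isSection_sec.star_autGraph γ
  rw [entry_coeff, Lam.mul_apply, map_sum, LinearMap.sum_apply, Finsupp.finsetSum_apply]
  simp only [comp_assoc]
  rw [Finset.sum_congr rfl fun j _ => comp_apply_eq_sum ℓ _ _ _, ← Fintype.sum_sigma']
  rw [MonoidAlgebra.coeff_sum, Finsupp.finsetSum_apply]
  -- only sections contribute to the coefficient at a section
  rw [← Fintype.sum_of_injective _ (SubquotientTriple.secOf_injective (G := G) (E := E)) _ _ ?_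
    fun _ => rfl]
  · rw [Fintype.sum_prod_type]
    refine Finset.sum_congr rfl fun r _ => ?_
    rw [MonoidAlgebra.coeff_mul_apply_right, Finsupp.sum_fintype _ _ (by simp)]
    refine Finset.sum_congr rfl fun β _ => ?_
    rw [entry_coeff, entry_coeff, ← star_autGraph_mul, ← comp_star_autGraph_apply, mul_comm]
    rfl
  · rintro ⟨j, W⟩ hW
    have hW' : ¬ IsSection W := fun h => hW (SubquotientTriple.mem_range_secOf h)
    rw [comp_single_apply_eq_zero ℓ _ hW' hZ, mul_zero]

variable (G E) in
/-- The representation of `Λ` by matrices over `𝕂 Aut(E)`: the action of `Λ` on the right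
`𝕂 Aut(E)`-module of sections onto `E`, a product that is not a section being zero. This module is
free, with the sections of the triples as a basis. -/
def matrixRep [DecidableEq ι] [DecidableEq (SubquotientTriple G E)] : Lam ℓ G →ₐ[𝕂]
    Matrix (SubquotientTriple G E) (SubquotientTriple G E) (MonoidAlgebra 𝕂 (MulAut E)) :=
  AlgHom.ofLinearMap
    { toFun := fun x => Matrix.of (entry ℓ G E x)
      map_add' := fun x y => by
        ext s t α
        simp [entry_coeff, Lam.add_apply]
      map_smul' := fun a x => by
        ext s t α
        simp [entry_coeff, Lam.smul_apply] }
    (by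
      ext s t : 1
      exact (entry_one ℓ s t).trans (Matrix.one_apply).symm)
    (fun x y => by
      ext s t : 1
      exact (entry_mul ℓ x y s t).trans (Matrix.mul_apply).symm)

theorem matrixRep_apply [DecidableEq ι] [DecidableEq (SubquotientTriple G E)] (x : Lam ℓ G)
    (s t : SubquotientTriple G E) (α : MulAut E) : (matrixRep ℓ G E x s t).coeff α =
      comp ℓ (x s.i t.i) (Finsupp.single t.sec 1) (star s.sec (autGraph α)) := rfl

end Representation

/-! ### The common kernel of the representations is nil -/

section Kernel

variable {𝕂 : Type*} [Field 𝕂] (ℓ : ℕ+ →* 𝕂ˣ)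

theorem exists_of_comp_single_apply_ne_zero {R S T : Type*} [Group R] [Group S] [Group T]
    [Finite S] {z : Subgroup (R × S) →₀ 𝕂} {V : Subgroup (S × T)} {b : 𝕂} {U : Subgroup (R × T)}
    (h : comp ℓ z (Finsupp.single V b) U ≠ 0) : ∃ Z, z Z ≠ 0 ∧ star Z V = U := by
  classical
  rw [← Finsupp.sum_single z, Finsupp.sum, map_sum, LinearMap.sum_apply,
    Finsupp.finsetSum_apply] at h
  obtain ⟨Z, hZ, hne⟩ := Finset.exists_ne_zero_of_sum_ne_zero h
  rw [comp_single, Finsupp.single_apply] at hne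
  exact ⟨Z, Finsupp.mem_support_iff.1 hZ, by by_contra hU; exact hne (if_neg hU)⟩

/-- If no section occurs in `x W`, where `W ≤ S × E`, then only morphisms of rank less than `|E|`
occur in `x` times `W * V`, which is `(x W) V` up to a nonzero scalar. -/
theorem rank_lt_of_comp_ne_zero {R S T E : Type*} [Group R] [Group S] [Group T] [Group E]
    [Finite R] [Finite S] [Finite E] {x : Subgroup (R × S) →₀ 𝕂} {W : Subgroup (S × E)}
    (hx : ∀ Z : Subgroup (R × E), IsSection Z → comp ℓ x (Finsupp.single W 1) Z = 0)
    {V : Subgroup (E × T)} {U : Subgroup (R × T)}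
    (hU : comp ℓ x (Finsupp.single (star W V) 1) U ≠ 0) : rank U < Nat.card E := by
  have h : Finsupp.single (star W V) (1 : 𝕂) =
      comp ℓ (Finsupp.single W 1) (Finsupp.single V (↑(sigma ℓ W V)⁻¹ : 𝕂)) := by
    simp [comp_single]
  rw [h, ← comp_assoc] at hU
  obtain ⟨Z, hZ, rfl⟩ := exists_of_comp_single_apply_ne_zero ℓ hU
  exact (rank_star_le Z V).trans_lt (rank_lt_of_not_isSection fun h => hZ (hx Z h))

variable {ι : Type*} {G : ι → Type*} [∀ i, Group (G i)] [∀ i, Finite (G i)] [Fintype ι]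

/-- If left multiplication by `x` lowers the rank of every morphism, then it lowers the bound `n` on
the ranks of the morphisms occurring in an element `y`. -/
theorem mul_apply_eq_zero_of_le_rank {x y : Lam ℓ G}
    (hx : ∀ (i j l : ι) (U : Subgroup (G j × G l)) (U' : Subgroup (G i × G l)),
      comp ℓ (x i j) (Finsupp.single U 1) U' ≠ 0 → rank U' < rank U) {n : ℕ}
    (hy : ∀ i l (U : Subgroup (G i × G l)), n + 1 ≤ rank U → y i l U = 0)
    (i l : ι) (U : Subgroup (G i × G l)) (hU : n ≤ rank U) : (x * y) i l U = 0 := by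
  rw [Lam.mul_apply, Finsupp.finsetSum_apply]
  refine Finset.sum_eq_zero fun j _ => ?_
  have := Fintype.ofFinite (Subgroup (G j × G l))
  rw [comp_apply_eq_sum]
  refine Finset.sum_eq_zero fun V _ => ?_
  by_contra! h
  have h1 := hx i j l V U (right_ne_zero_of_mul h)
  exact left_ne_zero_of_mul h (hy j l V (by omega))

variable [DecidableEq ι]

theorem comp_apply_eq_zero_of_matrixRep_eq_zero {E : Type*} [Group E] [Finite E]
    [DecidableEq (SubquotientTriple G E)] {x : Lam ℓ G}
    (hx : matrixRep ℓ G E x = 0) {i j : ι} {W : Subgroup (G j × E)} {Z : Subgroup (G i × E)}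
    (hW : IsSection W) (hZ : IsSection Z) : comp ℓ (x i j) (Finsupp.single W 1) Z = 0 := by
  obtain ⟨⟨t, β⟩, ht⟩ := SubquotientTriple.mem_range_secOf hW
  obtain ⟨⟨s, α⟩, hs⟩ := SubquotientTriple.mem_range_secOf hZ
  obtain ⟨rfl, ht⟩ := Sigma.mk.inj ht
  obtain rfl := eq_of_heq ht
  obtain ⟨rfl, hs⟩ := Sigma.mk.inj hs
  obtain rfl := eq_of_heq hs
  rw [comp_star_autGraph_apply, star_autGraph_mul, ← matrixRep_apply, hx]
  rfl

theorem isNilpotent_of_rank_lt {x : Lam ℓ G}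
    (hx : ∀ (i j l : ι) (U : Subgroup (G j × G l)) (U' : Subgroup (G i × G l)),
      comp ℓ (x i j) (Finsupp.single U 1) U' ≠ 0 → rank U' < rank U) : IsNilpotent x := by
  -- `N` bounds the ranks of all morphisms, so `N` multiplications by `x` kill everything
  obtain ⟨N, hN⟩ : ∃ N, ∀ i l (U : Subgroup (G i × G l)), rank U < N := by
    obtain ⟨N, hN⟩ := (Set.finite_range fun p : Σ i l, Subgroup (G i × G l) =>
      rank p.2.2).bddAbove
    exact ⟨N + 1, fun i l U => Nat.lt_succ_of_le (hN ⟨⟨i, l, U⟩, rfl⟩)⟩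
  have key : ∀ m n, N ≤ m + n → ∀ i l (U : Subgroup (G i × G l)), n ≤ rank U →
      (x ^ m) i l U = 0 := by
    intro m
    induction m with
    | zero =>
      intro n hn i l U hU
      have := hN i l U
      omega
    | succ m ih =>
      intro n hn
      rw [pow_succ']
      exact mul_apply_eq_zero_of_le_rank ℓ hx (ih (n + 1) (by omega))
  refine ⟨N, ?_⟩
  funext i l
  ext U
  exact key N 0 (by omega) i l U (Nat.zero_le _)

end Kernel

theorem eq_bot_of_forall_isNilpotent {A : Type*} [Ring A] [IsSemisimpleRing A] {I : Ideal A}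
    (h : ∀ x ∈ I, IsNilpotent x) : I = ⊥ := by
  obtain ⟨e, he, rfl⟩ := IsSemisimpleRing.ideal_eq_span_idempotent I
  obtain ⟨n, hn⟩ := h e (Ideal.mem_span_singleton_self e)
  have : e = 0 := by
    rcases Nat.eq_zero_or_pos n with rfl | hpos
    · rw [pow_zero] at hn
      rw [← one_mul e, hn, zero_mul]
    · rwa [he.pow_eq (by omega)] at hn
  simp [this]

/-! ### Counting morphisms -/

section Family

variable {ι : Type*} {G : ι → Type*} [∀ i, Group (G i)] {κ : Type*} {E : κ → Type*}
  [∀ k, Group (E k)]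

/-- The morphism `T_s * (T_t * α)°` with factor group `E k`, for triples `s` and `t` over `E k` with
chosen sections `T_s` and `T_t`, and an automorphism `α` of `E k`. -/
def morphismOf (p : Σ k, SubquotientTriple G (E k) × SubquotientTriple G (E k) × MulAut (E k)) :
    Σ i j, Subgroup (G i × G j) :=
  ⟨p.2.1.i, p.2.2.1.i, star p.2.1.sec (opp (star p.2.2.1.sec (autGraph p.2.2.2)))⟩

theorem morphismOf_injective (hE : ∀ k l, Nonempty (E k ≃* E l) → k = l) :
    Function.Injective (morphismOf : (Σ k, SubquotientTriple G (E k) × SubquotientTriple G (E k) ×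
      MulAut (E k)) → Σ i j, Subgroup (G i × G j)) := by
  -- the projections and the kernels of the morphism recover the two triples
  have hfst : ∀ {k} (s t : SubquotientTriple G (E k)) (α : MulAut (E k)),
      (⟨s.i, (star s.sec (opp (star t.sec (autGraph α)))).map (MonoidHom.fst _ _),
        leftKer (star s.sec (opp (star t.sec (autGraph α))))⟩ :
          Σ i, Subgroup (G i) × Subgroup (G i)) = s.data := by
    intro k s t α
    have h := t.isSection_sec.star_autGraph α
    rw [h.map_fst_star_opp, h.leftKer_star_opp, s.map_fst_sec, s.leftKer_sec]
    rfl
  have hsnd : ∀ {k} (s t : SubquotientTriple G (E k)) (α : MulAut (E k)),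
      (⟨t.i, (opp (star s.sec (opp (star t.sec (autGraph α))))).map (MonoidHom.fst _ _),
        leftKer (opp (star s.sec (opp (star t.sec (autGraph α)))))⟩ :
          Σ i, Subgroup (G i) × Subgroup (G i)) = t.data := by
    intro k s t α
    rw [opp_star, opp_opp, s.isSection_sec.map_fst_star_opp, s.isSection_sec.leftKer_star_opp,
      map_fst_star_autGraph, leftKer_star_autGraph, t.map_fst_sec, t.leftKer_sec]
    rfl
  rintro ⟨k, s, t, α⟩ ⟨k', s', t', α'⟩ h
  have hs : s.data = s'.data := by
    rw [← hfst s t α, ← hfst s' t' α']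
    exact congrArg (fun q : Σ i j, Subgroup (G i × G j) =>
      (⟨q.1, q.2.2.map (MonoidHom.fst _ _), leftKer q.2.2⟩ :
        Σ i, Subgroup (G i) × Subgroup (G i))) h
  have ht : t.data = t'.data := by
    rw [← hsnd s t α, ← hsnd s' t' α']
    exact congrArg (fun q : Σ i j, Subgroup (G i × G j) =>
      (⟨q.2.1, (opp q.2.2).map (MonoidHom.fst _ _), leftKer (opp q.2.2)⟩ :
        Σ i, Subgroup (G i) × Subgroup (G i))) h
  obtain rfl := hE _ _ (SubquotientTriple.nonempty_mulEquiv_of_data_eq hs)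
  obtain rfl := SubquotientTriple.data_injective hs
  obtain rfl := SubquotientTriple.data_injective ht
  obtain ⟨-, h⟩ := Sigma.mk.inj h
  obtain ⟨-, h⟩ := Sigma.mk.inj (eq_of_heq h)
  have h1 := congrArg opp (s.isSection_sec.star_left_cancel (eq_of_heq h))
  rw [opp_opp, opp_opp] at h1
  obtain rfl : α = α' := autGraph_injective (t.isSection_sec.star_left_cancel h1)
  rfl

end Family

end SubgroupCategory

end

open SubgroupCategory

theorem theorem1p2
    -- the coefficient field and the deformation parameter
    {𝕂 : Type*} [Field 𝕂] [CharZero 𝕂] (ℓ : ℕ+ →* 𝕂ˣ)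
    -- the finite set of finite groups
    {ι : Type*} [Fintype ι] [DecidableEq ι]
    (G : ι → Type u) [∀ i, Group (G i)] [∀ i, Finite (G i)]
    (hss : IsSemisimpleRing (SubgroupCategory.Lam ℓ G))
    -- representatives of the isomorphism classes of the factor groups of the `G i`
    {κ : Type*} (E : κ → Type*) [∀ k, Group (E k)]
    (hE_mem : ∀ k, ∃ i, SubgroupCategory.IsFactorGroup (E k) (G i))
    (hE_all : ∀ (i : ι) (F : Type u) [Group F], SubgroupCategory.IsFactorGroup F (G i) →
      ∃ k, Nonempty (F ≃* E k))
    (hE_inj : ∀ k l, Nonempty (E k ≃* E l) → k = l) :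
    Nonempty (SubgroupCategory.Lam ℓ G ≃ₐ[𝕂]
      (∀ k, Matrix (Fin (SubgroupCategory.numTriples G (E k)))
        (Fin (SubgroupCategory.numTriples G (E k))) (MonoidAlgebra 𝕂 (MulAut (E k))))) := by
  classical
  have hfin : ∀ k, Finite (E k) := by
    intro k
    obtain ⟨i, B, Y, hY, ⟨f⟩⟩ := hE_mem k
    exact Finite.of_equiv _ f.toEquiv
  have htriple : ∀ k, Nonempty (SubquotientTriple G (E k)) := by
    intro k
    obtain ⟨i, B, Y, hY, f⟩ := hE_mem k
    exact ⟨⟨i, B, Y, hY, f⟩⟩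
  have : Finite κ := by
    refine Finite.of_injective (fun k => (htriple k).some.data) fun k l h => ?_
    exact hE_inj k l (SubquotientTriple.nonempty_mulEquiv_of_data_eq h)
  have := Fintype.ofFinite κ
  let Φ : Lam ℓ G →ₐ[𝕂] ∀ k, Matrix (SubquotientTriple G (E k)) (SubquotientTriple G (E k))
      (MonoidAlgebra 𝕂 (MulAut (E k))) := AlgHom.pi fun k => matrixRep ℓ G (E k)
  have hinj : Function.Injective Φ := by
    -- the kernel is a nil ideal: its elements lower the rank of every morphism
    rw [← AlgHom.coe_toRingHom, RingHom.injective_iff_ker_eq_bot]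
    refine eq_bot_of_forall_isNilpotent fun x hx => isNilpotent_of_rank_lt ℓ ?_
    intro i j l U U' hU'
    have hn := normal_leftKer U
    obtain ⟨k, ⟨f⟩⟩ := hE_all j _ ⟨_, _, hn, ⟨MulEquiv.refl _⟩⟩
    obtain ⟨W, V, hW, hWV⟩ := exists_section_star_eq U
      (f := f.toMonoidHom.comp (QuotientGroup.mk' _))
      (f.surjective.comp (QuotientGroup.mk'_surjective _)) (by ext; simp)
    have hk : matrixRep ℓ G (E k) x = 0 := congrFun hx k
    have hrank : rank U = Nat.card (E k) := Nat.card_congr f.toEquiv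
    rw [← hWV] at hU'
    rw [hrank]
    exact rank_lt_of_comp_ne_zero ℓ
      (fun Z hZ => comp_apply_eq_zero_of_matrixRep_eq_zero ℓ hk hW hZ) hU'
  have hΛ : Module.Finite 𝕂 (Lam ℓ G) :=
    inferInstanceAs (Module.Finite 𝕂 (∀ i j : ι, Subgroup (G i × G j) →₀ 𝕂))
  have hA : ∀ k, Module.Finite 𝕂 (MonoidAlgebra 𝕂 (MulAut (E k))) := fun k =>
    Module.Finite.equiv (MonoidAlgebra.coeffLinearEquiv 𝕂).symm
  have hle : Module.finrank 𝕂 (∀ k, Matrix (SubquotientTriple G (E k))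
      (SubquotientTriple G (E k)) (MonoidAlgebra 𝕂 (MulAut (E k)))) ≤
      Module.finrank 𝕂 (Lam ℓ G) := by
    have (k : κ) : Fintype (MulAut (E k)) := Fintype.ofFinite _
    have (i j : ι) : Fintype (Subgroup (G i × G j)) := Fintype.ofFinite _
    have h1 : Module.finrank 𝕂 (Lam ℓ G) = Fintype.card (Σ i j, Subgroup (G i × G j)) := by
      change Module.finrank 𝕂 (∀ i j : ι, Subgroup (G i × G j) →₀ 𝕂) = _
      simp [Module.finrank_pi_fintype]
    have h2 (k : κ) : Module.finrank 𝕂 (MonoidAlgebra 𝕂 (MulAut (E k))) =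
        Fintype.card (MulAut (E k)) := by
      rw [(MonoidAlgebra.coeffLinearEquiv 𝕂).finrank_eq, Module.finrank_finsupp_self]
    rw [h1]
    refine le_trans (le_of_eq ?_) (Fintype.card_le_of_injective _
      (morphismOf_injective (G := G) hE_inj))
    simp only [Module.finrank_pi_fintype, Module.finrank_matrix, h2, Fintype.card_sigma,
      Fintype.card_prod, mul_assoc]
  have hbij : Function.Bijective Φ := by
    refine ⟨hinj, ?_⟩
    have heq := le_antisymm (LinearMap.finrank_le_finrank_of_injective
      (f := Φ.toLinearMap) hinj) hle
    exact (LinearMap.injective_iff_surjective_of_finrank_eq_finrank heq (f := Φ.toLinearMap)).1 hinj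
  exact ⟨(AlgEquiv.ofBijective Φ hbij).trans (AlgEquiv.piCongrRight fun k =>
    Matrix.reindexAlgEquiv 𝕂 _ (Finite.equivFin (SubquotientTriple G (E k))))⟩
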